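/- Let $N$ be a II$_1$ factor with property (T), and write $\|x\|_2=\tau(x^*x)^{1/2}$ in a II$_1$ factor with trace $\tau$. A *presentation* $M^\#$ of a II$_1$ factor $M$ is a sequence $(a_i)_{i\in\mathbb N}$ (the special points) in the operator-norm unit ball $M_1$ such that the set of rational points, i.e. the smallest subset of $M_1$ containing all $a_i$ and closed under products, adjoints and combinations $\lambda x+\mu y$ with $\lambda,\mu\in\mathbb Q(i)$, $|\lambda|+|\mu|\le 1$, is $\|\cdot\|_2$-dense in $M_1$. A finite set $F\subseteq N$ is a *Kazhdan set* if there are $\varepsilon,K>0$ such that for all $0<\delta\le\varepsilon$, every Hilbert $N$-$N$ bimodule $H$ and every unit vector $\xi\in H$ with $\|y\xi-\xi y\|<\delta$ for all $y\in F$, there is a central vector $\eta\in H$ with $\|\eta-\xi\|<K\delta$. A presentation of $N$ is a *Kazhdan presentation* if some Kazhdan set for $N$ consists of rational points of it. If $N$ is a subfactor of $M$, a *spectral gap function* for presentations $(M^\#,N^\dagger)$, where $N^\dagger$ has special points $a_0,a_1,\dots$, is an $f:\mathbb N\to\mathbb N$ such that for every $n$ and every rational point $p$ of $M^\#$: if $\|[p,a_i]\|_2<2^{-f(n)}$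 for the first $f(n)$ special points $a_i$, then the $\|\cdot\|_2$-distance from $p$ to $N'\cap M$ is less than $2^{-n}$. Let $N^\dagger$ be a Kazhdan presentation of $N$ with special points $(a_i)$. Let $M$ be any II$_1$ factor containing $N$ as a subfactor and let $M^\#$ be any presentation of $M$. Then: 1. $N$ has w-spectral gap in $M$: for each $\varepsilon>0$ there are a finite $F\subseteq N$ and $\delta>0$ such that each $x\in M_1$ with $\|[x,y]\|_2<\delta$ for all $y\in F$ is at $\|\cdot\|_2$-distance less than $\varepsilon$ from an element of $N'\cap M$. 2. There is a computable spectral gap function for $(M^\#,N^{\dagger\ast})$, where $N^{\dagger\ast}$ is the presentation of $N$ with special points $a_0,a_0^*,a_1,a_1^*,\dots$ (it has the same rational points as $N^\dagger$). 3. If each special point $a_i$ is normal (for instance self-adjoint or unitary) or has its adjoint again among the special points, then there is a computable spectral gap function for $(M^\#,N^\dagger)$. -/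

import Mathlib

universe u

noncomputable section

namespace TracialVN

variable {H : Type u} [NormedAddCommGroup H] [InnerProductSpace ℂ H] [CompleteSpace H]

/-- The elements of a von Neumann algebra `M` acting on `H`, as a type. -/
abbrev Elt (M : VonNeumannAlgebra H) : Type u := M.toStarSubalgebra

/-- A functional on `M` is positive and normal (ultraweakly continuous) when it is given by a
positive trace class operator, that is, `φ x = ∑ ⟪ξ i, x ξ i⟫` with `∑ ‖ξ i‖ ^ 2 < ∞`. -/
def IsNormalPositive (M : VonNeumannAlgebra H) (φ : Elt M → ℂ) : Prop :=
  ∃ ξ : ℕ → H, Summable (fun i => ‖ξ i‖ ^ 2) ∧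
    ∀ x : Elt M, HasSum (fun i => inner ℂ (ξ i) ((x : H →L[ℂ] H) (ξ i))) (φ x)

/-- Faithful normal tracial states on `M`. -/
structure TracialState (M : VonNeumannAlgebra H) where
  toLin : Elt M →ₗ[ℂ] ℂ
  normal : IsNormalPositive M toLin
  map_one : toLin 1 = 1
  trace : ∀ x y : Elt M, toLin (x * y) = toLin (y * x)
  faithful : ∀ x : Elt M, toLin (star x * x) = 0 → x = 0

/-- The norm `‖x‖₂ = τ(x* x) ^ (1/2)`. -/
def TracialState.norm2 {M : VonNeumannAlgebra H} (τ : TracialState M) (x : Elt M) : ℝ :=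
  Real.sqrt (τ.toLin (star x * x)).re

/-- The centre of `M` consists of the scalars. -/
def IsFactor (M : VonNeumannAlgebra H) : Prop :=
  ∀ z : Elt M, (∀ x : Elt M, z * x = x * z) → ∃ c : ℂ, z = c • 1

/-- A type II₁ factor: an infinite-dimensional factor with a faithful normal tracial state
(the latter is then unique). -/
structure IsIIOneFactor (M : VonNeumannAlgebra H) : Prop where
  factor : IsFactor M
  infinite : ¬ FiniteDimensional ℂ (Elt M)
  finite_type : Nonempty (TracialState M)

/-! ### Bimodules, property (T), Kazhdan sets -/

/-- A Hilbert `N`-`N` bimodule structure on `K`: commuting normal unital *-representations of `N`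
and of its opposite algebra. A *-representation is normal when all its positive vector functionals
are. -/
structure Bimodule (N : VonNeumannAlgebra H) (K : Type u) [NormedAddCommGroup K]
    [InnerProductSpace ℂ K] [CompleteSpace K] where
  left : Elt N →⋆ₐ[ℂ] (K →L[ℂ] K)
  right : (Elt N)ᵐᵒᵖ →⋆ₐ[ℂ] (K →L[ℂ] K)
  commute : ∀ (x y : Elt N) (ξ : K),
    left x (right (MulOpposite.op y) ξ) = right (MulOpposite.op y) (left x ξ)
  left_normal : ∀ ξ : K, IsNormalPositive N (fun x => inner ℂ ξ (left x ξ))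
  right_normal : ∀ ξ : K, IsNormalPositive N (fun x => inner ℂ ξ (right (MulOpposite.op x) ξ))

section

variable {N : VonNeumannAlgebra H} {K : Type u} [NormedAddCommGroup K]
    [InnerProductSpace ℂ K] [CompleteSpace K]

/-- The commutator `y ξ - ξ y`. -/
def Bimodule.comm (B : Bimodule N K) (y : Elt N) (ξ : K) : K :=
  B.left y ξ - B.right (MulOpposite.op y) ξ

/-- Central vectors: `y η = η y` for all `y`. -/
def Bimodule.IsCentral (B : Bimodule N K) (η : K) : Prop :=
  ∀ y : Elt N, B.comm y η = 0

end

/-- Property (T): there are a finite `F` and `ε > 0` such that each bimodule with an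
`(F, ε)`-almost central unit vector has a nonzero central vector. -/
def HasPropertyT (N : VonNeumannAlgebra H) : Prop :=
  ∃ F : Set (Elt N), F.Finite ∧ ∃ ε : ℝ, 0 < ε ∧
    ∀ (K : Type u) [NormedAddCommGroup K] [InnerProductSpace ℂ K] [CompleteSpace K]
      (B : Bimodule N K) (ξ : K), ‖ξ‖ = 1 → (∀ y ∈ F, ‖B.comm y ξ‖ < ε) →
      ∃ η : K, η ≠ 0 ∧ B.IsCentral η

/-- Kazhdan sets: finite `F` for which there are `ε, C > 0` such that for `0 < δ ≤ ε` each
`(F, δ)`-almost central unit vector is within `C δ` of a central vector. -/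
def IsKazhdanSet (N : VonNeumannAlgebra H) (F : Set (Elt N)) : Prop :=
  F.Finite ∧ ∃ ε C : ℝ, 0 < ε ∧ 0 < C ∧ ∀ δ : ℝ, 0 < δ → δ ≤ ε →
    ∀ (K : Type u) [NormedAddCommGroup K] [InnerProductSpace ℂ K] [CompleteSpace K]
      (B : Bimodule N K) (ξ : K), ‖ξ‖ = 1 → (∀ y ∈ F, ‖B.comm y ξ‖ < δ) →
      ∃ η : K, B.IsCentral η ∧ ‖η - ξ‖ < C * δ

/-! ### Presentations -/

/-- Complex numbers in `ℚ(i)`. -/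
def IsGaussianRational (c : ℂ) : Prop := ∃ q r : ℚ, c = (q : ℂ) + (r : ℂ) * Complex.I

/-- The smallest set of operators containing `A` and closed under rational rounded combinations,
products and adjoints. -/
inductive IsRationalPoint {M : VonNeumannAlgebra H} (A : Set (Elt M)) : Elt M → Prop
  | special (x : Elt M) : x ∈ A → IsRationalPoint A x
  | combination (c d : ℂ) (x y : Elt M) : IsGaussianRational c → IsGaussianRational d →
      ‖c‖ + ‖d‖ ≤ 1 → IsRationalPoint A x → IsRationalPoint A y →
      IsRationalPoint A (c • x + d • y)
  | mul (x y : Elt M) : IsRationalPoint A x → IsRationalPoint A y → IsRationalPoint A (x * y)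
  | adjoint (x : Elt M) : IsRationalPoint A x → IsRationalPoint A (star x)

/-- A presentation of `(M, τ)`: a sequence of special points in the operator norm unit ball whose
rational points are `‖ ‖₂`-dense in the unit ball. -/
structure Presentation {M : VonNeumannAlgebra H} (τ : TracialState M) where
  pt : ℕ → Elt M
  norm_le : ∀ n, ‖pt n‖ ≤ 1
  dense : ∀ x : Elt M, ‖x‖ ≤ 1 → ∀ ε : ℝ, 0 < ε →
    ∃ p : Elt M, IsRationalPoint (Set.range pt) p ∧ τ.norm2 (x - p) < ε

/-- The rational points of a presentation. -/
def Presentation.rationalPoints {M : VonNeumannAlgebra H} {τ : TracialState M}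
    (P : Presentation τ) : Set (Elt M) :=
  {p | IsRationalPoint (Set.range P.pt) p}

theorem IsRationalPoint.mono {M : VonNeumannAlgebra H} {A B : Set (Elt M)} (h : A ⊆ B)
    {x : Elt M} (hx : IsRationalPoint A x) : IsRationalPoint B x := by
  induction hx with
  | special x hx => exact .special x (h hx)
  | combination c d x y hc hd hcd _ _ hx hy => exact .combination c d x y hc hd hcd hx hy
  | mul x y _ _ hx hy => exact .mul x y hx hy
  | adjoint x _ hx => exact .adjoint x hx

/-- The presentation with special points `a 0, (a 0)*, a 1, (a 1)*, …`, where `a 0, a 1, …` are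
those of `P`. It has the same rational points as `P`. -/
def Presentation.withAdjoints {M : VonNeumannAlgebra H} {τ : TracialState M}
    (P : Presentation τ) : Presentation τ where
  pt i := if i % 2 = 0 then P.pt (i / 2) else star (P.pt (i / 2))
  norm_le i := by
    split_ifs
    · exact P.norm_le _
    · rw [norm_star]
      exact P.norm_le _
  dense x hx ε hε := by
    obtain ⟨p, hp, h⟩ := P.dense x hx ε hε
    refine ⟨p, hp.mono ?_, h⟩
    rintro _ ⟨n, rfl⟩
    exact ⟨2 * n, by simp⟩

/-- Some Kazhdan set consists of rational points. -/
def Presentation.IsKazhdan {N : VonNeumannAlgebra H} {σ : TracialState N}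
    (P : Presentation σ) : Prop :=
  ∃ F : Set (Elt N), IsKazhdanSet N F ∧ F ⊆ P.rationalPoints

/-! ### Spectral gap -/

section

variable {N M : VonNeumannAlgebra H}

/-- The inclusion of a von Neumann subalgebra. -/
def incl (h : N ≤ M) : Elt N →⋆ₐ[ℂ] Elt M := StarSubalgebra.inclusion h

/-- The relative commutant `N' ∩ M`. -/
def relCommutant (h : N ≤ M) : Set (Elt M) :=
  {z | ∀ y : Elt N, z * incl h y = incl h y * z}

/-- w-spectral gap of `N` in `(M, τ)`. -/
def HasWSpectralGap (h : N ≤ M) (τ : TracialState M) : Prop :=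
  ∀ ε : ℝ, 0 < ε → ∃ F : Set (Elt N), F.Finite ∧ ∃ δ : ℝ, 0 < δ ∧
    ∀ x : Elt M, ‖x‖ ≤ 1 → (∀ y ∈ F, τ.norm2 (x * incl h y - incl h y * x) < δ) →
      ∃ z ∈ relCommutant h, τ.norm2 (x - z) < ε

/-- `f` is a spectral gap function for the presentations `P` of `M` and `Q` of `N`: a rational
point `p` of `P` whose commutators with the first `f n` special points of `Q` all have `‖ ‖₂` less
than `2 ^ (- f n)` has `‖ ‖₂`-distance less than `2 ^ (-n)` from `N' ∩ M`. -/
def IsSpectralGapFunction (h : N ≤ M) {τ : TracialState M} {σ : TracialState N}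
    (P : Presentation τ) (Q : Presentation σ) (f : ℕ → ℕ) : Prop :=
  ∀ n : ℕ, ∀ p ∈ P.rationalPoints,
    (∀ i < f n, τ.norm2 (p * incl h (Q.pt i) - incl h (Q.pt i) * p) < (2 : ℝ)⁻¹ ^ f n) →
      ∃ z ∈ relCommutant h, τ.norm2 (p - z) < (2 : ℝ)⁻¹ ^ n

end

end TracialVN

end

set_option linter.unusedSectionVars false

noncomputable section

namespace TracialVN

variable {H : Type u} [NormedAddCommGroup H] [InnerProductSpace ℂ H] [CompleteSpace H]

open Filter Topology

/-! The bimodule to which the Kazhdan property is applied is L²(M, τ), restricted to N on both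
sides. A rational point x of the unit ball that almost commutes with a Kazhdan set F is, after
normalisation, an almost central unit vector, hence close to a central vector η. But η need not come
from M. Since the unit ball of M is convex and complete in ‖·‖₂ (`isClosed_image_ball`), it has a
unique point z nearest to η. Conjugation by a unitary of N fixes η and maps the ball into itself
contractively, so it fixes z; hence z lies in N' ∩ M, and it is as close to x as η is, up to a
factor 2. The linear dependence on δ in a Kazhdan set survives normalisation, and gives a linear gap
(`exists_linear_gap`).

When F consists of rational points, the Leibniz rule bounds commutators with F linearly by those
with finitely many special points and their adjoints (`exists_commNorm_bound`). All losses are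
therefore constant factors, and n ↦ n + constant is a spectral gap function. It is computable
although the constant is obtained without any algorithm. The adjoints are supplied by the enlarged
presentation, by the special points themselves, or by normality (`commNorm_star_of_isStarNormal`).
-/

/-- The Hilbert sum of countably many copies of `H`. -/
abbrev Amplification (H : Type u) [NormedAddCommGroup H] : Type u := lp (fun _ : ℕ => H) 2

/-! ### Operators acting diagonally on the amplification. -/

theorem memℓp_two_of_summable {ξ : ℕ → H} (h : Summable fun i => ‖ξ i‖ ^ 2) :
    Memℓp ξ 2 := by
  refine memℓp_gen ?_
  simpa using h

theorem summable_norm_sq (η : Amplification H) : Summable fun i => ‖η i‖ ^ 2 := by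
  have := (lp.memℓp η).summable (by norm_num)
  simpa using this

theorem summable_norm_sq_apply (x : H →L[ℂ] H) {ξ : ℕ → H} (h : Summable fun i => ‖ξ i‖ ^ 2) :
    Summable fun i => ‖x (ξ i)‖ ^ 2 := by
  refine Summable.of_nonneg_of_le (fun _ => by positivity) (fun i => ?_) (h.mul_left (‖x‖ ^ 2))
  rw [← mul_pow]
  gcongr
  exact x.le_opNorm _

/-- The diagonal action of an operator on the amplification. -/
def diag (x : H →L[ℂ] H) : Amplification H →L[ℂ] Amplification H :=
  LinearMap.mkContinuous
    { toFun := fun η =>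
        ⟨fun i => x (η i), memℓp_two_of_summable (summable_norm_sq_apply x (summable_norm_sq η))⟩
      map_add' := fun η ζ => by ext i; exact map_add x _ _
      map_smul' := fun c η => by ext i; exact map_smul x c _ }
    ‖x‖ (fun η => by
      have : ‖x‖ * ‖η‖ = ‖((‖x‖ : ℂ) • η)‖ := by
        rw [norm_smul, Complex.norm_real, norm_norm]
      rw [this]
      refine lp.norm_mono (by norm_num) fun i => ?_
      rw [lp.coeFn_smul, Pi.smul_apply, norm_smul, Complex.norm_real, norm_norm]
      exact x.le_opNorm (η i))

@[simp]
theorem diag_apply (x : H →L[ℂ] H) (η : Amplification H) (i : ℕ) : diag x η i = x (η i) := rfl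

theorem norm_diag_apply_le (x : H →L[ℂ] H) (η : Amplification H) : ‖diag x η‖ ≤ ‖x‖ * ‖η‖ :=
  (diag x).le_of_opNorm_le (LinearMap.mkContinuous_norm_le _ (norm_nonneg _) _) η

theorem inner_diag_left (x : H →L[ℂ] H) (η ζ : Amplification H) :
    inner ℂ (diag x η) ζ = inner ℂ η (diag (star x) ζ) := by
  rw [lp.inner_eq_tsum, lp.inner_eq_tsum]
  refine tsum_congr fun i => ?_
  simp [ContinuousLinearMap.star_eq_adjoint, ContinuousLinearMap.adjoint_inner_right]

variable {N M : VonNeumannAlgebra H}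

/-! ### Norm closedness, unitaries and the bicommutant. -/

theorem isClosed_coe (M : VonNeumannAlgebra H) : IsClosed (M.toStarSubalgebra : Set (H →L[ℂ] H)) := by
  have h : (M.toStarSubalgebra : Set (H →L[ℂ] H)) =
      Set.centralizer (Set.centralizer (M : Set (H →L[ℂ] H))) := by simp
  rw [h]
  exact Set.isClosed_centralizer _

theorem span_unitary_eq_top (M : VonNeumannAlgebra H) :
    Submodule.span ℂ (unitary (Elt M) : Set (Elt M)) = ⊤ := by
  have : IsClosed (M.toStarSubalgebra : Set (H →L[ℂ] H)) := isClosed_coe M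
  exact CStarAlgebra.span_unitary (Elt M)

theorem mem_of_forall_commute {x : H →L[ℂ] H}
    (h : ∀ y ∈ Set.centralizer (M : Set (H →L[ℂ] H)), y * x = x * y) :
    x ∈ M.toStarSubalgebra := by
  rw [VonNeumannAlgebra.mem_carrier, ← M.centralizer_centralizer]
  exact h

/-! ### The space L²(M, τ) and its bimodule structure. -/

namespace TracialState

variable (τ : TracialState M)

/-- A sequence of vectors implementing the trace. -/
def vec : ℕ → H := τ.normal.choose

theorem summable_vec : Summable fun i => ‖τ.vec i‖ ^ 2 := τ.normal.choose_spec.1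

theorem hasSum_vec (x : Elt M) :
    HasSum (fun i => inner ℂ (τ.vec i) ((x : H →L[ℂ] H) (τ.vec i))) (τ.toLin x) :=
  τ.normal.choose_spec.2 x

/-- The vectors implementing the trace, as a vector of the amplification. -/
def root : Amplification H := ⟨τ.vec, memℓp_two_of_summable τ.summable_vec⟩

/-- The space `L²(M, τ)`, as a subspace of the amplification. -/
def ltwo : Submodule ℂ (Amplification H) :=
  (LinearMap.range
    ({ toFun := fun x => diag (x : H →L[ℂ] H) τ.root
       map_add' := fun x y => by ext i; simp
       map_smul' := fun c x => by ext i; simp } : Elt M →ₗ[ℂ] Amplification H)).topologicalClosure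

instance : CompleteSpace τ.ltwo := by
  unfold ltwo
  infer_instance

/-- The inclusion of `M` in `L²(M, τ)`. -/
def toLtwo : Elt M →ₗ[ℂ] τ.ltwo where
  toFun x := ⟨diag (x : H →L[ℂ] H) τ.root, Submodule.le_topologicalClosure _ ⟨x, rfl⟩⟩
  map_add' x y := by ext i; simp
  map_smul' c x := by ext i; simp

@[simp]
theorem coe_toLtwo (x : Elt M) :
    (τ.toLtwo x : Amplification H) = diag (x : H →L[ℂ] H) τ.root := rfl

theorem denseRange_toLtwo : DenseRange τ.toLtwo := by
  intro η
  have h := η.2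
  rw [closure_subtype]
  unfold ltwo at h
  rw [← SetLike.mem_coe, Submodule.topologicalClosure_coe] at h
  refine closure_mono ?_ h
  rintro _ ⟨x, rfl⟩
  exact ⟨_, ⟨x, rfl⟩, rfl⟩

theorem inner_toLtwo (x y : Elt M) :
    inner ℂ (τ.toLtwo x) (τ.toLtwo y) = τ.toLin (star x * y) := by
  rw [Submodule.coe_inner, coe_toLtwo, coe_toLtwo, lp.inner_eq_tsum,
    ← (τ.hasSum_vec (star x * y)).tsum_eq]
  refine tsum_congr fun i => ?_
  simp [ContinuousLinearMap.star_eq_adjoint, ContinuousLinearMap.adjoint_inner_right, root]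

theorem norm2_eq (x : Elt M) : τ.norm2 x = ‖τ.toLtwo x‖ := by
  rw [norm2, ← inner_toLtwo, @norm_eq_sqrt_re_inner ℂ]
  rfl

theorem toLtwo_injective : Function.Injective τ.toLtwo := by
  rw [injective_iff_map_eq_zero]
  intro x hx
  exact τ.faithful x (by rw [← inner_toLtwo, hx, inner_zero_left])

theorem norm_toLtwo_star (x : Elt M) : ‖τ.toLtwo (star x)‖ = ‖τ.toLtwo x‖ := by
  rw [← norm2_eq, ← norm2_eq, norm2, norm2, star_star, τ.trace]

theorem norm_toLtwo_mul_le (x y : Elt M) : ‖τ.toLtwo (x * y)‖ ≤ ‖x‖ * ‖τ.toLtwo y‖ := by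
  have : (τ.toLtwo (x * y) : Amplification H) = diag (x : H →L[ℂ] H) (τ.toLtwo y) := by
    ext i; simp
  change ‖(τ.toLtwo (x * y) : Amplification H)‖ ≤ _
  rw [this]
  exact norm_diag_apply_le _ _

theorem norm_toLtwo_mul_le' (x y : Elt M) : ‖τ.toLtwo (x * y)‖ ≤ ‖τ.toLtwo x‖ * ‖y‖ := by
  rw [← norm_toLtwo_star, star_mul, mul_comm, ← norm_star y, ← τ.norm_toLtwo_star x]
  exact τ.norm_toLtwo_mul_le _ _

/-- Left multiplication on `L²(M, τ)`. -/
def leftMul (x : Elt M) : τ.ltwo →L[ℂ] τ.ltwo :=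
  ((diag (x : H →L[ℂ] H)).comp τ.ltwo.subtypeL).codRestrict τ.ltwo (by
    have h : IsClosed {η : τ.ltwo | diag (x : H →L[ℂ] H) η ∈ τ.ltwo} :=
      IsClosed.preimage (by fun_prop) (Submodule.isClosed_topologicalClosure _)
    refine τ.denseRange_toLtwo.induction ?_ h
    rintro _ ⟨y, rfl⟩
    have : diag (x : H →L[ℂ] H) (τ.toLtwo y) = τ.toLtwo (x * y) := by ext i; simp
    change diag (x : H →L[ℂ] H) (τ.toLtwo y) ∈ τ.ltwo
    rw [this]
    exact Subtype.property _)

@[simp]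
theorem coe_leftMul (x : Elt M) (η : τ.ltwo) :
    (τ.leftMul x η : Amplification H) = diag (x : H →L[ℂ] H) η := rfl

@[simp]
theorem leftMul_toLtwo (x y : Elt M) : τ.leftMul x (τ.toLtwo y) = τ.toLtwo (x * y) := by
  ext i; simp

theorem inner_leftMul_left (x : Elt M) (η ζ : τ.ltwo) :
    inner ℂ (τ.leftMul x η) ζ = inner ℂ η (τ.leftMul (star x) ζ) := by
  rw [Submodule.coe_inner, Submodule.coe_inner, coe_leftMul, coe_leftMul, inner_diag_left]
  rfl

theorem adjoint_leftMul (x : Elt M) : star (τ.leftMul x) = τ.leftMul (star x) := by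
  rw [ContinuousLinearMap.star_eq_adjoint, eq_comm, ContinuousLinearMap.eq_adjoint_iff]
  intro η ζ
  rw [inner_leftMul_left, star_star]

/-- The *-representation of `M` on `L²(M, τ)` by left multiplication. -/
def leftRep : Elt M →⋆ₐ[ℂ] (τ.ltwo →L[ℂ] τ.ltwo) where
  toFun := τ.leftMul
  map_one' := by ext η i; simp
  map_mul' x y := by ext η i; simp
  map_zero' := by ext η i; simp
  map_add' x y := by ext η i; simp
  commutes' c := by ext η i; simp [Algebra.algebraMap_eq_smul_one]
  map_star' x := (τ.adjoint_leftMul x).symm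

/-- The conjugation `x ↦ x*` on `L²(M, τ)`. -/
def conj : τ.ltwo ≃ₗᵢ⋆[ℂ] τ.ltwo :=
  (starLinearEquiv ℂ (A := Elt M)).extendOfIsometry τ.toLtwo τ.toLtwo τ.denseRange_toLtwo
    τ.denseRange_toLtwo τ.norm_toLtwo_star

@[simp]
theorem conj_toLtwo (x : Elt M) : τ.conj (τ.toLtwo x) = τ.toLtwo (star x) :=
  LinearEquiv.extendOfIsometry_eq _ _ _ _ _ _ _

@[simp]
theorem conj_conj (η : τ.ltwo) : τ.conj (τ.conj η) = η := by
  refine τ.denseRange_toLtwo.induction (P := fun η => τ.conj (τ.conj η) = η) ?_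
    (isClosed_eq (by fun_prop) continuous_id) η
  rintro _ ⟨x, rfl⟩
  simp

theorem inner_conj (η ζ : τ.ltwo) : inner ℂ (τ.conj η) (τ.conj ζ) = inner ℂ ζ η := by
  refine τ.denseRange_toLtwo.induction_on₂
    (p := fun η ζ => inner ℂ (τ.conj η) (τ.conj ζ) = inner ℂ ζ η)
    (isClosed_eq ((τ.conj.continuous.comp continuous_fst).inner (𝕜 := ℂ)
      (τ.conj.continuous.comp continuous_snd))
      (Continuous.inner (𝕜 := ℂ) (E := τ.ltwo) continuous_snd continuous_fst)) (fun x y => ?_) η ζ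
  rw [conj_toLtwo, conj_toLtwo, inner_toLtwo, inner_toLtwo, star_star, τ.trace]

theorem inner_conj_left (η ζ : τ.ltwo) : inner ℂ (τ.conj η) ζ = inner ℂ (τ.conj ζ) η := by
  rw [← inner_conj, conj_conj]

/-- Right multiplication on `L²(M, τ)`. -/
def rightMul (x : Elt M) : τ.ltwo →L[ℂ] τ.ltwo where
  -- On the amplification x acts only from the left, so the right action is J x* J, with J the
  -- isometric conjugation; boundedness is then automatic.
  toFun η := τ.conj (τ.leftMul (star x) (τ.conj η))
  map_add' η ζ := by simp
  map_smul' c η := by simp [map_smulₛₗ]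
  cont := by fun_prop

theorem rightMul_apply (x : Elt M) (η : τ.ltwo) :
    τ.rightMul x η = τ.conj (τ.leftMul (star x) (τ.conj η)) := rfl

@[simp]
theorem rightMul_toLtwo (x y : Elt M) : τ.rightMul x (τ.toLtwo y) = τ.toLtwo (y * x) := by
  simp [rightMul_apply]

theorem adjoint_rightMul (x : Elt M) : star (τ.rightMul x) = τ.rightMul (star x) := by
  rw [ContinuousLinearMap.star_eq_adjoint, eq_comm, ContinuousLinearMap.eq_adjoint_iff]
  intro η ζ
  have := τ.inner_conj (τ.conj η) (τ.leftMul (star x) (τ.conj ζ))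
  rw [conj_conj] at this
  rw [rightMul_apply, rightMul_apply, inner_conj_left, star_star, this, inner_leftMul_left,
    star_star]

theorem eq_of_eqOn_toLtwo {f g : τ.ltwo →L[ℂ] τ.ltwo}
    (h : ∀ x, f (τ.toLtwo x) = g (τ.toLtwo x)) : f = g := by
  ext1 η
  refine τ.denseRange_toLtwo.induction (P := fun η => f η = g η) ?_
    (isClosed_eq (by fun_prop) (by fun_prop)) η
  rintro _ ⟨x, rfl⟩
  exact h x

theorem leftMul_rightMul (x y : Elt M) (η : τ.ltwo) :
    τ.leftMul x (τ.rightMul y η) = τ.rightMul y (τ.leftMul x η) := by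
  have : (τ.leftMul x).comp (τ.rightMul y) = (τ.rightMul y).comp (τ.leftMul x) :=
    τ.eq_of_eqOn_toLtwo fun z => by simp [mul_assoc]
  exact congrArg (fun f => f η) this

/-- The coordinates of η in the amplification are the vectors that `IsNormalPositive` asks for.
Realising L²(M, τ) there makes normality of the left action immediate. -/
theorem hasSum_inner_leftMul (x : Elt M) (η : τ.ltwo) :
    HasSum (fun i => inner ℂ ((η : Amplification H) i)
      ((x : H →L[ℂ] H) ((η : Amplification H) i))) (inner ℂ η (τ.leftMul x η)) :=
  lp.hasSum_inner (η : Amplification H) (τ.leftMul x η : Amplification H)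

/-- Reduces normality of the right action at η to that of the left action at `τ.conj η`. -/
theorem inner_rightMul_self (x : Elt M) (η : τ.ltwo) :
    inner ℂ η (τ.rightMul x η) = inner ℂ (τ.conj η) (τ.leftMul x (τ.conj η)) := by
  rw [rightMul_apply, ← inner_conj, conj_conj, inner_leftMul_left, star_star]

/-- The space `L²(M, τ)` as a bimodule over a subalgebra `N` of `M`. -/
def bimodule (h : N ≤ M) : Bimodule N τ.ltwo where
  left := τ.leftRep.comp (incl h)
  right :=
    { toFun := fun x => τ.rightMul (incl h x.unop)
      map_one' := τ.eq_of_eqOn_toLtwo fun z => by simp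
      map_mul' := fun x y => τ.eq_of_eqOn_toLtwo fun z => by simp [mul_assoc]
      map_zero' := τ.eq_of_eqOn_toLtwo fun z => by simp
      map_add' := fun x y => τ.eq_of_eqOn_toLtwo fun z => by simp [mul_add]
      commutes' := fun c => τ.eq_of_eqOn_toLtwo fun z => by simp [Algebra.algebraMap_eq_smul_one]
      map_star' := fun x => by
        rw [MulOpposite.unop_star, map_star, adjoint_rightMul] }
  commute x y η := τ.leftMul_rightMul _ _ η
  left_normal η := ⟨fun i => (η : Amplification H) i, summable_norm_sq _, fun x =>
    τ.hasSum_inner_leftMul (incl h x) η⟩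
  right_normal η := ⟨fun i => (τ.conj η : Amplification H) i, summable_norm_sq _, fun x => by
    have := τ.hasSum_inner_leftMul (incl h x) (τ.conj η)
    rw [← inner_rightMul_self] at this
    exact this⟩

theorem bimodule_comm_toLtwo (h : N ≤ M) (y : Elt N) (x : Elt M) :
    (τ.bimodule h).comm y (τ.toLtwo x) = τ.toLtwo (incl h y * x - x * incl h y) := by
  rw [map_sub, ← leftMul_toLtwo, ← rightMul_toLtwo]
  rfl

end TracialState

/-! ### Completeness of the unit ball in ‖·‖₂. -/

/-- Bounded sequences of operators have weak limits along ultrafilters. -/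
theorem exists_weak_limit (U : Ultrafilter ℕ) (x : ℕ → H →L[ℂ] H) (hx : ∀ n, ‖x n‖ ≤ 1) :
    ∃ z : H →L[ℂ] H, ‖z‖ ≤ 1 ∧
      ∀ v w, Tendsto (fun n => inner ℂ (x n v) w) U (𝓝 (inner ℂ (z v) w)) := by
  have hb : ∀ v w n, ‖inner ℂ (x n v) w‖ ≤ ‖v‖ * ‖w‖ := fun v w n =>
    (norm_inner_le_norm _ _).trans (by
      gcongr
      simpa using (x n).le_of_opNorm_le (hx n) v)
  have hlim : ∀ v w, ∃ c : ℂ, ‖c‖ ≤ ‖v‖ * ‖w‖ ∧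
      Tendsto (fun n => inner ℂ (x n v) w) U (𝓝 c) := by
    intro v w
    obtain ⟨c, hc, h⟩ := (isCompact_closedBall (0 : ℂ) (‖v‖ * ‖w‖)).ultrafilter_le_nhds
      (U.map fun n => inner ℂ (x n v) w) (by
        rw [le_principal_iff]
        exact Eventually.of_forall (f := (U : Filter ℕ)) fun n => by simpa using hb v w n)
    exact ⟨c, by simpa using hc, h⟩
  choose B hB hlim using hlim
  -- The limits form a bounded sesquilinear form, which the Riesz representation turns into an
  -- operator.
  let B' : H →ₗ⋆[ℂ] H →ₗ[ℂ] ℂ := LinearMap.mk₂'ₛₗ (starRingEnd ℂ) (RingHom.id ℂ) B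
    (fun v v' w => tendsto_nhds_unique (hlim _ _) (by
      simpa [inner_add_left] using (hlim v w).add (hlim v' w)))
    (fun c v w => tendsto_nhds_unique (hlim _ _) (by
      simpa [inner_smul_left, mul_comm] using (hlim v w).const_mul (starRingEnd ℂ c)))
    (fun v w w' => tendsto_nhds_unique (hlim _ _) (by
      simpa [inner_add_right] using (hlim v w).add (hlim v w')))
    (fun c v w => tendsto_nhds_unique (hlim _ _) (by
      simpa [inner_smul_right] using (hlim v w).const_mul c))
  let B'' : H →L⋆[ℂ] H →L[ℂ] ℂ := B'.mkContinuous₂ 1 fun v w => by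
    rw [one_mul]
    exact hB v w
  have hz : ∀ v w, inner ℂ (InnerProductSpace.continuousLinearMapOfBilin B'' v) w = B v w :=
    fun v w => InnerProductSpace.continuousLinearMapOfBilin_apply B'' v w
  refine ⟨InnerProductSpace.continuousLinearMapOfBilin B'', ?_, fun v w => ?_⟩
  · refine ContinuousLinearMap.opNorm_le_of_unit_norm zero_le_one fun v hv => ?_
    set a := InnerProductSpace.continuousLinearMapOfBilin B'' v with ha
    have h1 : ‖a‖ * ‖a‖ ≤ ‖a‖ := by
      have := hB v a
      rw [← hz, ← ha, hv, one_mul, inner_self_eq_norm_sq_to_K, norm_pow, RCLike.norm_ofReal,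
        abs_norm, sq] at this
      exact this
    nlinarith [norm_nonneg a]
  · rw [hz]
    exact hlim v w

/-- The operator norm unit ball of `M` is complete in the norm `‖ ‖₂`. -/
theorem TracialState.isClosed_image_ball (τ : TracialState M) :
    IsClosed (τ.toLtwo '' {x | ‖x‖ ≤ 1}) := by
  refine isClosed_of_closure_subset fun η hη => ?_
  obtain ⟨s, hs, hlim⟩ := mem_closure_iff_seq_limit.1 hη
  choose x hx hxs using hs
  obtain ⟨z, hz1, hz⟩ := exists_weak_limit (hyperfilter ℕ) (fun n => (x n : H →L[ℂ] H)) hx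
  have hzM : z ∈ M.toStarSubalgebra := by
    -- Commuting with each y in the commutant of M passes to weak limits, so the limit lies in the
    -- bicommutant.
    refine mem_of_forall_commute fun y hy => ?_
    ext v
    refine ext_inner_right ℂ fun w => ?_
    have h1 := hz v (ContinuousLinearMap.adjoint y w)
    have h2 := hz (y v) w
    simp only [ContinuousLinearMap.adjoint_inner_right] at h1
    refine tendsto_nhds_unique h1 (h2.congr fun n => ?_)
    have := congrArg (fun f : H →L[ℂ] H => f v) (hy (x n) (x n).2)
    simp only [mul_apply_eq_comp] at this
    rw [this]
  refine ⟨⟨z, hzM⟩, hz1, ?_⟩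
  ext i
  refine ext_inner_right ℂ fun w => ?_
  -- Each coordinate of `s n` converges weakly to that of `z` applied to the trace vectors, and in
  -- norm to that of `η`.
  refine tendsto_nhds_unique (hz (τ.root i) w) ?_
  have h : Tendsto (fun n => (s n : Amplification H) i) atTop (𝓝 ((η : Amplification H) i)) := by
    rw [tendsto_iff_norm_sub_tendsto_zero] at hlim ⊢
    refine squeeze_zero (fun _ => norm_nonneg _) (fun n => ?_) hlim
    exact lp.norm_apply_le_norm (by norm_num) ((s n - η : τ.ltwo) : Amplification H) i
  have h' := (h.mono_left Nat.hyperfilter_le_atTop).inner (𝕜 := ℂ) (tendsto_const_nhds (x := w))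
  refine h'.congr fun n => ?_
  rw [← hxs]
  rfl

/-! ### From central vectors to the relative commutant. -/

/-- By the parallelogram law, two distinct nearest points would have a midpoint strictly nearer to
η. Uniqueness is put as an inequality so that it applies to images of v under contractions fixing η.
-/
theorem exists_unique_nearest {E : Type*} [NormedAddCommGroup E] [InnerProductSpace ℂ E]
    {D : Set E} (hne : D.Nonempty) (hc : IsComplete D) (hconv : Convex ℝ D) (η : E) :
    ∃ v ∈ D, ∀ w ∈ D, ‖η - v‖ ≤ ‖η - w‖ ∧ (‖η - w‖ ≤ ‖η - v‖ → w = v) := by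
  let _ : InnerProductSpace ℝ E := InnerProductSpace.rclikeToReal ℂ E
  obtain ⟨v, hv, h⟩ := exists_norm_eq_iInf_of_complete_convex hne hc hconv η
  have hmin : ∀ w ∈ D, ‖η - v‖ ≤ ‖η - w‖ := fun w hw => by
    rw [h]
    exact ciInf_le (f := fun w : D => ‖η - w‖) ⟨0, by rintro _ ⟨_, rfl⟩; exact norm_nonneg _⟩ ⟨w, hw⟩
  refine ⟨v, hv, fun w hw => ⟨hmin w hw, fun hle => ?_⟩⟩
  have hmid := hmin _ (hconv hv hw (by norm_num : (0 : ℝ) ≤ 1 / 2) (by norm_num : (0 : ℝ) ≤ 1 / 2)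
    (by norm_num))
  have hsum : (η - v) + (η - w) = (2 : ℝ) • (η - ((1 / 2 : ℝ) • v + (1 / 2 : ℝ) • w)) := by
    module
  have hpar := parallelogram_law_with_norm ℝ (η - v) (η - w)
  rw [hsum, norm_smul, sub_sub_sub_cancel_left, Real.norm_of_nonneg zero_le_two] at hpar
  have h0 : ‖w - v‖ * ‖w - v‖ ≤ 0 := by
    nlinarith [norm_nonneg (η - v), norm_nonneg (η - w)]
  have : ‖w - v‖ = 0 := by nlinarith [norm_nonneg (w - v)]
  exact sub_eq_zero.1 (norm_eq_zero.1 this)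

theorem mem_relCommutant_of_unitary (h : N ≤ M) {z : Elt M}
    (hz : ∀ u ∈ unitary (Elt N), z * incl h u = incl h u * z) : z ∈ relCommutant h := by
  intro y
  have hy : y ∈ Submodule.span ℂ (unitary (Elt N) : Set (Elt N)) := by
    rw [span_unitary_eq_top]; trivial
  induction hy using Submodule.span_induction with
  | mem u hu => exact hz u hu
  | zero => simp
  | add a b _ _ ha hb => rw [map_add, mul_add, add_mul, ha, hb]
  | smul c a _ ha => rw [map_smul, mul_smul_comm, smul_mul_assoc, ha]

theorem norm_le_one_of_mem_unitary {u : Elt N} (hu : u ∈ unitary (Elt N)) : ‖u‖ ≤ 1 := by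
  have h1 : star (u : H →L[ℂ] H) * u = 1 := congrArg Subtype.val (Unitary.star_mul_self_of_mem hu)
  have h2 := CStarRing.norm_star_mul_self (x := (u : H →L[ℂ] H))
  rw [h1] at h2
  have h3 : ‖(1 : H →L[ℂ] H)‖ ≤ 1 := ContinuousLinearMap.norm_id_le
  change ‖(u : H →L[ℂ] H)‖ ≤ 1
  nlinarith [norm_nonneg (u : H →L[ℂ] H)]

theorem norm_incl (h : N ≤ M) (y : Elt N) : ‖incl h y‖ = ‖y‖ := rfl

namespace TracialState

variable (τ : TracialState M)

theorem norm_leftMul_le (x : Elt M) (η : τ.ltwo) : ‖τ.leftMul x η‖ ≤ ‖x‖ * ‖η‖ :=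
  norm_diag_apply_le _ _

theorem norm_rightMul_le (x : Elt M) (η : τ.ltwo) : ‖τ.rightMul x η‖ ≤ ‖x‖ * ‖η‖ := by
  rw [rightMul_apply, LinearIsometryEquiv.norm_map, ← norm_star x, ← τ.conj.norm_map η]
  exact τ.norm_leftMul_le _ _

/-- An element of the unit ball near a central vector is near the relative commutant. -/
theorem exists_mem_relCommutant_of_central (h : N ≤ M) {x : Elt M} (hx : ‖x‖ ≤ 1) {η : τ.ltwo}
    (hη : (τ.bimodule h).IsCentral η) :
    ∃ z ∈ relCommutant h, ‖τ.toLtwo (x - z)‖ ≤ 2 * ‖η - τ.toLtwo x‖ := by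
  have hconv : Convex ℝ (τ.toLtwo '' {x | ‖x‖ ≤ 1}) := by
    have h1 : Convex ℝ {x : Elt M | ‖x‖ ≤ 1} := by
      simpa [Metric.closedBall, dist_zero_right] using convex_closedBall (0 : Elt M) 1
    exact h1.is_linear_image (f := τ.toLtwo)
      ⟨map_add _, fun c y => (τ.toLtwo.restrictScalars ℝ).map_smul c y⟩
  obtain ⟨_, ⟨z, hz1, rfl⟩, hz⟩ := exists_unique_nearest (D := τ.toLtwo '' {x | ‖x‖ ≤ 1})
    ⟨τ.toLtwo x, x, hx, rfl⟩ τ.isClosed_image_ball.isComplete hconv η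
  refine ⟨z, mem_relCommutant_of_unitary h fun u hu => ?_, ?_⟩
  · have hu1 : ‖incl h u‖ ≤ 1 := by
      rw [norm_incl]
      exact norm_le_one_of_mem_unitary hu
    have hu2 : ‖star (incl h u)‖ ≤ 1 := by rwa [norm_star]
    have huu : incl h u * star (incl h u) = 1 := by
      rw [← map_star, ← map_mul, Unitary.mul_star_self_of_mem hu, _root_.map_one]
    have hη' : τ.rightMul (star (incl h u)) (τ.leftMul (incl h u) η) = η := by
      have h1 : τ.leftMul (incl h u) η = τ.rightMul (incl h u) η := sub_eq_zero.1 (hη u)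
      have h2 : (τ.rightMul (star (incl h u))).comp (τ.rightMul (incl h u)) = .id ℂ _ :=
        τ.eq_of_eqOn_toLtwo fun w => by simp [mul_assoc, huu]
      rw [h1]
      exact congrArg (fun f => f η) h2
    -- Conjugation by u is a contraction fixing η, so u z u* is no farther from η than z; uniqueness
    -- gives u z u* = z.
    have key := (hz (τ.toLtwo (incl h u * z * star (incl h u))) ⟨_, ?_, rfl⟩).2 ?_
    · have := τ.toLtwo_injective key
      have huu' : star (incl h u) * incl h u = 1 := by
        rw [← map_star, ← map_mul, Unitary.star_mul_self_of_mem hu, _root_.map_one]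
      calc z * incl h u = incl h u * z * star (incl h u) * incl h u := by rw [this]
        _ = incl h u * z := by rw [mul_assoc, huu', mul_one]
    · refine (norm_mul_le _ _).trans (mul_le_one₀ ?_ (norm_nonneg _) hu2)
      exact (norm_mul_le _ _).trans (mul_le_one₀ hu1 (norm_nonneg _) hz1)
    · rw [← rightMul_toLtwo, ← leftMul_toLtwo]
      nth_rewrite 1 [← hη']
      rw [← map_sub, ← map_sub]
      refine (τ.norm_rightMul_le _ _).trans ?_
      refine (mul_le_of_le_one_left (norm_nonneg _) hu2).trans ?_
      refine (τ.norm_leftMul_le _ _).trans ?_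
      exact mul_le_of_le_one_left (norm_nonneg _) hu1
  -- The factor 2: x itself competes for the nearest point, so z is at least as close to η as x is.
  · have h1 := (hz _ ⟨x, hx, rfl⟩).1
    rw [map_sub]
    have h2 := norm_sub_le_norm_sub_add_norm_sub (τ.toLtwo x) η (τ.toLtwo z)
    rw [norm_sub_rev (τ.toLtwo x) η] at h2
    linarith

/-- Elements of the unit ball that almost commute with a Kazhdan set are near the relative
commutant, with a linear bound. -/
theorem exists_linear_gap (h : N ≤ M) {F : Set (Elt N)} (hF : IsKazhdanSet N F) :
    ∃ C : ℝ, 0 < C ∧ ∀ δ : ℝ, 0 < δ → ∀ x : Elt M, ‖x‖ ≤ 1 →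
      (∀ y ∈ F, τ.norm2 (x * incl h y - incl h y * x) < δ) →
      ∃ z ∈ relCommutant h, τ.norm2 (x - z) < C * δ := by
  obtain ⟨-, ε, C, hε, hC, hK⟩ := hF
  -- The term `ε⁻¹` serves short x, with ‖x‖₂ ≤ δ/ε, which are approximated by 0; the term `2 * C`
  -- serves the others.
  refine ⟨2 * C + ε⁻¹, by positivity, fun δ hδ x hx hcomm => ?_⟩
  simp only [norm2_eq] at hcomm ⊢
  set r := ‖τ.toLtwo x‖ with hr
  rcases le_or_gt (r * ε) δ with hle | hlt
  · refine ⟨0, fun y => by simp, ?_⟩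
    rw [sub_zero, ← hr, add_mul]
    have : r ≤ ε⁻¹ * δ := by rwa [inv_mul_eq_div, le_div_iff₀ hε]
    nlinarith [mul_pos hC hδ]
  have hr0 : 0 < r := by
    by_contra hcon
    nlinarith [norm_nonneg (τ.toLtwo x)]
  have hrC : ‖((r⁻¹ : ℝ) : ℂ)‖ = r⁻¹ := by
    rw [Complex.norm_real, Real.norm_of_nonneg (by positivity)]
  -- The unit vector x/r has commutators below δ/r. Rescaling its error C(δ/r) by r gives Cδ,
  -- whatever r is.
  obtain ⟨η, hη, hnear⟩ := hK (δ / r) (by positivity) (by rw [div_le_iff₀ hr0]; linarith)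
    τ.ltwo (τ.bimodule h) (((r⁻¹ : ℝ) : ℂ) • τ.toLtwo x)
    (by rw [norm_smul, hrC, ← hr, inv_mul_cancel₀ hr0.ne']) (fun y hy => by
      rw [← map_smul, bimodule_comm_toLtwo, mul_smul_comm, smul_mul_assoc, ← smul_sub, map_smul,
        norm_smul, hrC, inv_mul_eq_div, ← neg_sub, map_neg, norm_neg]
      exact div_lt_div_of_pos_right (hcomm y hy) hr0)
  have hcen : (τ.bimodule h).IsCentral ((r : ℂ) • η) := fun y => by
    have := hη y
    rw [Bimodule.comm] at this ⊢
    rw [map_smul, map_smul, ← smul_sub, this, smul_zero]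
  obtain ⟨z, hz, hz'⟩ := τ.exists_mem_relCommutant_of_central h hx hcen
  refine ⟨z, hz, hz'.trans_lt ?_⟩
  have h1 : (r : ℂ) • η - τ.toLtwo x = (r : ℂ) • (η - ((r⁻¹ : ℝ) : ℂ) • τ.toLtwo x) := by
    rw [smul_sub, smul_smul, ← Complex.ofReal_mul, mul_inv_cancel₀ hr0.ne', Complex.ofReal_one,
      one_smul]
  rw [h1, norm_smul, Complex.norm_real, Real.norm_of_nonneg hr0.le]
  have h2 : r * ‖η - ((r⁻¹ : ℝ) : ℂ) • τ.toLtwo x‖ < r * (C * (δ / r)) :=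
    mul_lt_mul_of_pos_left hnear hr0
  have h3 : r * (C * (δ / r)) = C * δ := by field_simp
  have h4 : 0 < ε⁻¹ * δ := by positivity
  linarith

end TracialState

theorem hasWSpectralGap_of_isKazhdanSet (h : N ≤ M) (τ : TracialState M) {F : Set (Elt N)}
    (hF : IsKazhdanSet N F) : HasWSpectralGap h τ := by
  intro ε hε
  obtain ⟨C, hC, hgap⟩ := τ.exists_linear_gap h hF
  refine ⟨F, hF.1, ε / C, by positivity, fun x hx hcomm => ?_⟩
  obtain ⟨z, hz, hlt⟩ := hgap (ε / C) (by positivity) x hx hcomm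
  exact ⟨z, hz, by rwa [mul_div_cancel₀ _ hC.ne'] at hlt⟩

/-! ### Commutators with rational points -/

theorem IsRationalPoint.norm_le {A : Set (Elt M)} (hA : ∀ a ∈ A, ‖a‖ ≤ 1) {x : Elt M}
    (hx : IsRationalPoint A x) : ‖x‖ ≤ 1 := by
  induction hx with
  | special x hx => exact hA x hx
  | combination c d x y _ _ hcd _ _ hx hy =>
    refine (norm_add_le _ _).trans ?_
    rw [norm_smul, norm_smul]
    nlinarith [norm_nonneg c, norm_nonneg d]
  | mul x y _ _ hx hy => exact (norm_mul_le _ _).trans (mul_le_one₀ hx (norm_nonneg _) hy)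
  | adjoint x _ hx => rwa [norm_star]

/-- The norm `‖x y - y x‖₂` of a commutator. -/
def TracialState.commNorm (τ : TracialState M) (h : N ≤ M) (x : Elt M) (y : Elt N) : ℝ :=
  τ.norm2 (x * incl h y - incl h y * x)

namespace TracialState

variable (τ : TracialState M) (h : N ≤ M)

theorem commNorm_combination_le (x : Elt M) (c d : ℂ) (y z : Elt N) :
    τ.commNorm h x (c • y + d • z) ≤ ‖c‖ * τ.commNorm h x y + ‖d‖ * τ.commNorm h x z := by
  simp only [commNorm, norm2_eq]
  have : x * incl h (c • y + d • z) - incl h (c • y + d • z) * x =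
      c • (x * incl h y - incl h y * x) + d • (x * incl h z - incl h z * x) := by
    simp only [map_add, map_smul, mul_add, add_mul, mul_smul_comm, smul_mul_assoc, smul_sub]
    abel
  rw [this, map_add, map_smul, map_smul, ← norm_smul, ← norm_smul]
  exact norm_add_le _ _

/-- Leibniz rule [x, yz] = [x, y]z + y[x, z]; traciality bounds right multiplication in ‖·‖₂ by the
operator norm. -/
theorem commNorm_mul_le (x : Elt M) (y z : Elt N) :
    τ.commNorm h x (y * z) ≤ τ.commNorm h x y * ‖z‖ + ‖y‖ * τ.commNorm h x z := by
  simp only [commNorm, norm2_eq]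
  have : x * incl h (y * z) - incl h (y * z) * x =
      (x * incl h y - incl h y * x) * incl h z + incl h y * (x * incl h z - incl h z * x) := by
    rw [map_mul]
    noncomm_ring
  rw [this, map_add]
  exact (norm_add_le _ _).trans
    (add_le_add (τ.norm_toLtwo_mul_le' _ (incl h z)) (τ.norm_toLtwo_mul_le (incl h y) _))

theorem toLin_star (x : Elt M) : τ.toLin (star x) = starRingEnd ℂ (τ.toLin x) := by
  have h1 := τ.inner_toLtwo x 1
  have h2 := τ.inner_toLtwo 1 x
  rw [mul_one] at h1
  rw [star_one, one_mul] at h2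
  rw [← h1, ← h2]
  exact (_root_.inner_conj_symm (𝕜 := ℂ) (τ.toLtwo x) (τ.toLtwo 1)).symm

/-- Commutators with a normal element and with its adjoint have the same `‖ ‖₂`. -/
theorem commNorm_star_of_isStarNormal (x : Elt M) {y : Elt N} (hy : IsStarNormal y) :
    τ.commNorm h x (star y) = τ.commNorm h x y := by
  set a := incl h y with ha
  have hn : star a * a = a * star a := by
    rw [ha, ← map_star, ← map_mul, ← map_mul, hy.star_comm_self.eq]
  -- Expand both squared norms into four traces. Normality matches the square terms; the cross terms
  -- match up to complex conjugation by traciality alone, and only real parts enter.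
  have h1 : τ.toLin (a * (star x * (x * star a))) = τ.toLin (star a * (star x * (x * a))) := by
    rw [τ.trace a, τ.trace (star a)]
    simp only [mul_assoc]
    rw [hn]
  have h2 : τ.toLin (star x * (a * (star a * x))) = τ.toLin (star x * (star a * (a * x))) := by
    rw [← mul_assoc a, ← hn, mul_assoc]
  have h3 : τ.toLin (a * (star x * (star a * x))) =
      starRingEnd ℂ (τ.toLin (star a * (star x * (a * x)))) := by
    rw [← toLin_star]
    simp only [star_mul, star_star, mul_assoc]
    rw [τ.trace a]
    simp only [mul_assoc]
  have h4 : τ.toLin (star x * (a * (x * star a))) =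
      starRingEnd ℂ (τ.toLin (star x * (star a * (x * a)))) := by
    rw [← toLin_star]
    simp only [star_mul, star_star, mul_assoc]
    rw [τ.trace (star a)]
    simp only [mul_assoc]
  rw [commNorm, commNorm, map_star, ← ha, norm2, norm2]
  congr 1
  simp only [star_sub, star_mul, star_star, sub_mul, mul_sub, mul_assoc, map_sub, h1, h2, h3, h4,
    Complex.sub_re, Complex.conj_re]

/-- Induction on how y is built. Carrying the bound for `star y` along makes the adjoint case a
swap; `m` and `L` depend on neither x nor δ. -/
theorem exists_commNorm_bound {A : ℕ → Elt N} {y : Elt N}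
    (hy : IsRationalPoint (Set.range A) y) :
    ∃ (m : ℕ) (L : ℝ), ∀ δ : ℝ, ∀ x : Elt M,
      (∀ i < m, τ.commNorm h x (A i) ≤ δ ∧ τ.commNorm h x (star (A i)) ≤ δ) →
      τ.commNorm h x y ≤ L * δ ∧ τ.commNorm h x (star y) ≤ L * δ := by
  induction hy with
  | special y hy =>
    obtain ⟨i, rfl⟩ := hy
    refine ⟨i + 1, 1, fun δ x hx => ?_⟩
    simpa using hx i (Nat.lt_succ_self i)
  | combination c d y z _ _ _ _ _ hy hz =>
    obtain ⟨m, L, hL⟩ := hy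
    obtain ⟨m', L', hL'⟩ := hz
    refine ⟨max m m', ‖c‖ * L + ‖d‖ * L', fun δ x hx => ?_⟩
    obtain ⟨h1, h2⟩ := hL δ x fun i hi => hx i (lt_max_of_lt_left hi)
    obtain ⟨h1', h2'⟩ := hL' δ x fun i hi => hx i (lt_max_of_lt_right hi)
    rw [add_mul, mul_assoc, mul_assoc]
    constructor
    · refine (τ.commNorm_combination_le h x c d y z).trans ?_
      gcongr
    · rw [star_add, star_smul, star_smul]
      refine (τ.commNorm_combination_le h x _ _ _ _).trans ?_
      rw [norm_star, norm_star]
      gcongr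
  | mul y z _ _ hy hz =>
    obtain ⟨m, L, hL⟩ := hy
    obtain ⟨m', L', hL'⟩ := hz
    refine ⟨max m m', L * ‖z‖ + ‖y‖ * L', fun δ x hx => ?_⟩
    obtain ⟨h1, h2⟩ := hL δ x fun i hi => hx i (lt_max_of_lt_left hi)
    obtain ⟨h1', h2'⟩ := hL' δ x fun i hi => hx i (lt_max_of_lt_right hi)
    have e : (L * ‖z‖ + ‖y‖ * L') * δ = L * δ * ‖z‖ + ‖y‖ * (L' * δ) := by ring
    rw [e]
    constructor
    · refine (τ.commNorm_mul_le h x y z).trans ?_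
      gcongr
    · rw [star_mul]
      refine (τ.commNorm_mul_le h x _ _).trans ?_
      rw [norm_star, norm_star, add_comm, mul_comm ‖z‖, mul_comm _ ‖y‖]
      gcongr
  | adjoint y _ hy =>
    obtain ⟨m, L, hL⟩ := hy
    refine ⟨m, L, fun δ x hx => ?_⟩
    rw [star_star]
    exact (hL δ x hx).symm

theorem exists_commNorm_bound_finite {A : ℕ → Elt N} {F : Set (Elt N)} (hF : F.Finite)
    (hFA : ∀ y ∈ F, IsRationalPoint (Set.range A) y) :
    ∃ (m : ℕ) (L : ℝ), 0 < L ∧ ∀ δ : ℝ, 0 < δ → ∀ x : Elt M,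
      (∀ i < m, τ.commNorm h x (A i) ≤ δ ∧ τ.commNorm h x (star (A i)) ≤ δ) →
      ∀ y ∈ F, τ.commNorm h x y < L * δ := by
  induction F, hF using Set.Finite.induction_on with
  | empty => exact ⟨0, 1, one_pos, by simp⟩
  | @insert y F _ _ ih =>
    obtain ⟨m, L, hL0, hL⟩ := ih fun z hz => hFA z (Set.mem_insert_of_mem _ hz)
    obtain ⟨m', L', hL'⟩ := τ.exists_commNorm_bound h (hFA y (Set.mem_insert _ _))
    -- `L'` carries no sign, hence `|L'|`; the positive `L` makes the inequality strict for the new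
    -- element.
    refine ⟨max m m', L + |L'|, by positivity, fun δ hδ x hx z hz => ?_⟩
    rw [add_mul]
    rcases hz with rfl | hz
    · have h1 := (hL' δ x fun i hi => hx i (lt_max_of_lt_right hi)).1
      nlinarith [le_abs_self L', mul_pos hL0 hδ]
    · have h1 := hL δ hδ x (fun i hi => hx i (lt_max_of_lt_left hi)) z hz
      have : 0 ≤ |L'| * δ := by positivity
      linarith

end TracialState

/-! ### Computable spectral gap functions. -/

/-- If the commutators with finitely many special points of `Q` control those with each special
point of `A` and its adjoint, and `A` is Kazhdan, then there is a computable spectral gap function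
for `Q`. -/
theorem exists_computable_isSpectralGapFunction (h : N ≤ M) {τ : TracialState M}
    {σ : TracialState N} (P : Presentation τ) {A : Presentation σ} (hA : A.IsKazhdan)
    (Q : Presentation σ)
    (hQ : ∀ i, ∃ k, ∀ δ : ℝ, ∀ x : Elt M, (∀ j < k, τ.commNorm h x (Q.pt j) ≤ δ) →
      τ.commNorm h x (A.pt i) ≤ δ ∧ τ.commNorm h x (star (A.pt i)) ≤ δ) :
    ∃ f : ℕ → ℕ, Computable f ∧ IsSpectralGapFunction h P Q f := by
  obtain ⟨F, hF, hFA⟩ := hA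
  obtain ⟨C, hC, hgap⟩ := τ.exists_linear_gap h hF
  obtain ⟨m, L, hL0, hL⟩ := τ.exists_commNorm_bound_finite h hF.1 hFA
  choose k hk using hQ
  obtain ⟨l, hl⟩ := pow_unbounded_of_one_lt (C * L) (one_lt_two (α := ℝ))
  -- The supremum ensures that enough special points of `Q` are tested; `l` absorbs the factor C L <
  -- 2 ^ l.
  refine ⟨fun n => n + (l + (Finset.range m).sup k), ?_, fun n p hp hcomm => ?_⟩
  · exact (Primrec.nat_add.comp Primrec.id (Primrec.const _)).to_comp
  set t := l + (Finset.range m).sup k with ht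
  have hpos : (0 : ℝ) < 2⁻¹ ^ (n + t) := by positivity
  have hcomm' : ∀ i < m, ∀ j < k i, τ.commNorm h p (Q.pt j) ≤ 2⁻¹ ^ (n + t) := fun i hi j hj => by
    have : k i ≤ (Finset.range m).sup k := Finset.le_sup (Finset.mem_range.2 hi)
    exact (hcomm j (by change j < n + t; omega)).le
  obtain ⟨z, hz, hlt⟩ := hgap (L * 2⁻¹ ^ (n + t)) (by positivity) p
    (IsRationalPoint.norm_le (by rintro _ ⟨i, rfl⟩; exact P.norm_le i) hp)
    (hL _ hpos p fun i hi => hk i _ p (hcomm' i hi))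
  refine ⟨z, hz, hlt.trans_le ?_⟩
  have h1 : C * L ≤ 2 ^ t :=
    hl.le.trans (pow_le_pow_right₀ one_le_two (Nat.le_add_right _ _))
  calc C * (L * (2 : ℝ)⁻¹ ^ (n + t)) = (C * L) * 2⁻¹ ^ (n + t) := by ring
    _ ≤ 2 ^ t * 2⁻¹ ^ (n + t) := by gcongr
    _ = 2⁻¹ ^ n := by
      rw [pow_add (2 : ℝ)⁻¹, mul_comm ((2 : ℝ)⁻¹ ^ n), ← mul_assoc, ← mul_pow]
      norm_num

end TracialVN

end

theorem mainTheorem4 {H : Type u} [NormedAddCommGroup H] [InnerProductSpace ℂ H] [CompleteSpace H]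
    (N : VonNeumannAlgebra H) (hN : TracialVN.IsIIOneFactor N) (hT : TracialVN.HasPropertyT N)
    (σ : TracialVN.TracialState N) (A : TracialVN.Presentation σ) (hA : A.IsKazhdan)
    (M : VonNeumannAlgebra H) (hM : TracialVN.IsIIOneFactor M) (hNM : N ≤ M)
    (τ : TracialVN.TracialState M) (P : TracialVN.Presentation τ) :
    TracialVN.HasWSpectralGap hNM τ ∧
    (∃ f : ℕ → ℕ, Computable f ∧
      TracialVN.IsSpectralGapFunction hNM P A.withAdjoints f) ∧
    ((∀ n, IsStarNormal (A.pt n) ∨ ∃ m, A.pt m = star (A.pt n)) →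
      ∃ f : ℕ → ℕ, Computable f ∧ TracialVN.IsSpectralGapFunction hNM P A f) := by
  refine ⟨?_, ?_, fun hadj => ?_⟩
  · obtain ⟨F, hF, -⟩ := hA
    exact TracialVN.hasWSpectralGap_of_isKazhdanSet hNM τ hF
  · refine TracialVN.exists_computable_isSpectralGapFunction hNM P hA _ fun i =>
      -- Indices 2i and 2i + 1 carry the i-th special point and its adjoint.
      ⟨2 * i + 2, fun δ x hx => ⟨?_, ?_⟩⟩
    · have := hx (2 * i) (by omega)
      simpa [TracialVN.Presentation.withAdjoints] using this
    · have := hx (2 * i + 1) (by omega)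
      simpa [TracialVN.Presentation.withAdjoints, Nat.add_mod,
        show (2 * i + 1) / 2 = i by omega] using this
  · refine TracialVN.exists_computable_isSpectralGapFunction hNM P hA _ fun i => ?_
    rcases hadj i with hn | ⟨m, hm⟩
    · refine ⟨i + 1, fun δ x hx => ?_⟩
      rw [τ.commNorm_star_of_isStarNormal hNM x hn]
      exact ⟨hx i (by omega), hx i (by omega)⟩
    · refine ⟨max i m + 1, fun δ x hx => ?_⟩
      rw [← hm]
      exact ⟨hx i (by omega), hx m (by omega)⟩
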